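/- Let $X$ be a finite non-empty ground set with a matroid $\mathcal I$ on it, let $y$ be a random variable, and let $f(S,y)$, $S\subseteq X$, be measurable in $y$ and, for every realization of $y$, a normalized ($f(\emptyset,y)=0$), monotone non-decreasing and submodular set function of $S$. Let $\alpha\in(0,1]$, $\Gamma>0$, $\Delta\in(0,\Gamma]$, put $$H(S,\tau)=\tau-\tfrac1\alpha\,\mathbb E\big[(\tau-f(S,y))_+\big],$$ and let $(S^\star,\tau^\star)$ maximize $H(S,\tau)$ over $S\in\mathcal I$, $\tau\in[0,\Gamma]$. Let $k_f\in[0,1]$ be the curvature of $H$ in $S$ over $\mathcal I$, that is, $$k_f=1-\inf\frac{H(S,\tau)-H(S\setminus\{s\},\tau)}{H(\{s\},\tau)-H(\emptyset,\tau)},$$ the infimum being over $\tau\in[0,\Gamma]$, $S\in\mathcal I$ and $s\in S$ with $H(\{s\},\tau)\ne H(\emptyset,\tau)$ ($k_f=0$ if there are none). Sequential Greedy Algorithm (SGA): from $n_s$ independent samples $\tilde y_1,\dots,\tilde y_{n_s}$ of $y$ form $\hat H(S,\tau)=\tau-\frac1{n_s\alpha}\sum_j(\tau-f(S,\tilde y_j))_+$.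 For $i=0,1,\dots,\lceil\Gamma/\Delta\rceil$ let $\tau_i=i\Delta$; start with $S_i=\emptyset$ and, as long as some $s\in X\setminus S_i$ has $S_i\cup\{s\}\in\mathcal I$, add to $S_i$ such an $s$ with the largest marginal gain $\hat H(S_i\cup\{s\},\tau_i)-\hat H(S_i,\tau_i)$. Return a pair $(S^G,\tau^G)$ among the $(S_i,\tau_i)$ with the largest $\hat H(S_i,\tau_i)$. Ties are broken arbitrarily. Then there are universal constants $C>0$ and $K$ such that the following holds for all such data. 1. For all $\varepsilon>0$ and $\delta\in(0,1)$, if $$n_s\ \ge\ C\,\frac{|X|^3}{\alpha^2}\cdot\frac{\Gamma^2}{\varepsilon^2}\log\frac2\delta$$ (so that, for given $X$ and $\alpha$, $n_s=O\big(\frac{\Gamma^2}{\varepsilon^2}\log\frac1\delta\big)$ samples suffice as $\varepsilon,\delta\to0$), then with probability at least $1-\delta$, for every way of breaking ties, $S^G\in\mathcal I$ and $$H(S^G,\tau^G)\ \ge\ \frac1{1+k_f}\big(H(S^\star,\tau^\star)-\Delta\big)-\frac{k_f}{1+k_f}\,\Gamma\Big(\frac1\alpha-1\Big)-\varepsilon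 .$$ 2. If $n_s\ge1$, SGA runs in at most $K\,\lceil\Gamma/\Delta\rceil\,|X|^2\,n_s$ steps, where evaluating $f(S,\tilde y)$ at a set and a sample, testing whether a set is in $\mathcal I$, an arithmetic operation or a comparison of numbers, testing membership in a set and adding an element to a set each count as one step. -/

import Mathlib

open MeasureTheory

/-! ### Set functions, curvature and the auxiliary function of CVaR -/

/-- Submodularity: marginal gains do not increase as the set grows. -/
def IsSubmodular {X : Type*} [DecidableEq X] (g : Finset X → ℝ) : Prop :=
  ∀ S T : Finset X, S ⊆ T → ∀ s, s ∉ T → g (insert s T) - g T ≤ g (insert s S) - g S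

/-- The quotients whose minimum enters the curvature of `g` over the matroid `M`:
`(g S - g (S \ {s})) / (g {s} - g ∅)` for independent `S` and `s ∈ S`.  The function is normalized
by subtracting `g ∅`, and elements of zero value are left out. -/
def curvatureRatios {X : Type*} [DecidableEq X] (M : Matroid X) (g : Finset X → ℝ) : Set ℝ :=
  {r | ∃ (S : Finset X) (s : X), M.Indep (S : Set X) ∧ s ∈ S ∧ g {s} ≠ g ∅ ∧
    r = (g S - g (S.erase s)) / (g {s} - g ∅)}

/-- Curvature of `g` over the matroid `M`.  The quotient `1` is attained at every independent
singleton of non-zero value; inserting it only matters if there is no such singleton, where the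
curvature is then `0`. -/
noncomputable def curvature {X : Type*} [DecidableEq X] (M : Matroid X) (g : Finset X → ℝ) : ℝ :=
  1 - sInf (insert 1 (curvatureRatios M g))

/-- The auxiliary function `H(S, τ) = τ - (1/α) E[(τ - f(S, y))₊]`, where `y` has law `ν`. -/
noncomputable def auxH {X Y : Type*} [MeasurableSpace Y] (ν : Measure Y) (f : Finset X → Y → ℝ)
    (α : ℝ) (S : Finset X) (τ : ℝ) : ℝ :=
  τ - 1 / α * ∫ y, max (τ - f S y) 0 ∂ν

/-- Curvature of `H(S, τ)` in `S`, over all admissible `τ ∈ [0, Γ]`. -/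
noncomputable def auxCurvature {X Y : Type*} [DecidableEq X] [MeasurableSpace Y] (M : Matroid X)
    (ν : Measure Y) (f : Finset X → Y → ℝ) (α Γ : ℝ) : ℝ :=
  sSup ((fun τ => curvature M (fun S => auxH ν f α S τ)) '' Set.Icc 0 Γ)

/-- `(S, τ)` is an optimal solution of: maximize `H(S, τ)` over `S` independent, `τ ∈ [0, Γ]`. -/
def IsOptimalPair {X Y : Type*} [MeasurableSpace Y] (M : Matroid X)
    (ν : Measure Y) (f : Finset X → Y → ℝ) (α Γ : ℝ) (S : Finset X) (τ : ℝ) : Prop :=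
  M.Indep (S : Set X) ∧ τ ∈ Set.Icc 0 Γ ∧
    ∀ (S' : Finset X) (τ' : ℝ), M.Indep (S' : Set X) → τ' ∈ Set.Icc 0 Γ →
      auxH ν f α S' τ' ≤ auxH ν f α S τ

/-! ### Computations with a step count -/

/-- The result of a computation together with the number of elementary steps it takes. -/
structure Timed (β : Type*) where
  val : β
  cost : ℕ

namespace Timed

/-- Return a value that has already been computed. -/
def ret {β : Type*} (b : β) : Timed β := ⟨b, 0⟩

/-- One elementary step.  It is used for: a query `f(S, y)`, an independence query, an arithmetic
operation or a comparison of numbers, a membership test, adding an element to a set or a list. -/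
def tick {β : Type*} (b : β) : Timed β := ⟨b, 1⟩

/-- Sequential composition; the costs add up. -/
def bind {β γ : Type*} (m : Timed β) (k : β → Timed γ) : Timed γ :=
  ⟨(k m.val).val, m.cost + (k m.val).cost⟩

end Timed

/-! ### The Sequential Greedy Algorithm -/

section Algorithm

open Timed

/-- `∑ (τ - f(S, y))₊` over a list of samples. -/
noncomputable def sumShortfall {X Y : Type*} (f : Finset X → Y → ℝ) (S : Finset X) (τ : ℝ) :
    List Y → Timed ℝ
  | [] => ret 0
  | y :: ys =>
      (tick (f S y)).bind fun v =>
      (tick (τ - v)).bind fun d =>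
      (tick (max d 0)).bind fun p =>
      (sumShortfall f S τ ys).bind fun r =>
      tick (p + r)

/-- The sampling oracle `Ĥ(S, τ) = τ - (1 / (n α)) ∑ (τ - f(S, y))₊`, the sum being over the
`n` samples. -/
noncomputable def oracleH {X Y : Type*} (f : Finset X → Y → ℝ) (α : ℝ) (ys : List Y)
    (S : Finset X) (τ : ℝ) : Timed ℝ :=
  (sumShortfall f S τ ys).bind fun r =>
  (tick ((ys.length : ℝ) * α)).bind fun c =>
  (tick (r / c)).bind fun q =>
  tick (τ - q)

open Classical in
/-- The elements `s ∉ S` of a list with `S ∪ {s}` independent, together with their marginal gains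
`Ĥ(S ∪ {s}, τ) - Ĥ(S, τ)`, where `hS` is the value `Ĥ(S, τ)`. -/
noncomputable def marginalGains {X Y : Type*} [DecidableEq X] (M : Matroid X)
    (f : Finset X → Y → ℝ) (α : ℝ)
    (ys : List Y) (S : Finset X) (τ hS : ℝ) : List X → Timed (List (X × ℝ))
  | [] => ret []
  | s :: l =>
      (marginalGains M f α ys S τ hS l).bind fun rest =>
      (tick (decide (s ∈ S))).bind fun inS =>
      if inS then ret rest else
        (tick (insert s S)).bind fun T =>
        (tick (decide (M.Indep (T : Set X)))).bind fun ok =>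
        if ok then
          (oracleH f α ys T τ).bind fun h =>
          (tick (h - hS)).bind fun g =>
          tick ((s, g) :: rest)
        else ret rest

open Classical in
/-- An entry of largest value of a list of pairs (candidate, value), or `none` for the empty list.
Equal values are decided by the rule `tie`. -/
noncomputable def argmaxEntry {β : Type*} (tie : β → β → Bool) :
    List (β × ℝ) → Timed (Option (β × ℝ))
  | [] => ret none
  | p :: l =>
      (argmaxEntry tie l).bind fun r =>
      match r with
      | none => ret (some p)
      | some q =>
          (tick (decide (q.2 < p.2 ∨ (q.2 = p.2 ∧ tie p.1 q.1 = true)))).bind fun b =>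
          ret (some (if b then p else q))

/-- At most the given number of greedy rounds for fixed `τ`, starting from a set.  The loop ends
as soon as no element can be added. -/
noncomputable def greedyRounds {X Y : Type*} [DecidableEq X] (M : Matroid X)
    (f : Finset X → Y → ℝ) (α : ℝ)
    (ys : List Y) (tie : Finset X → X → X → Bool) (xs : List X) (τ : ℝ) :
    ℕ → Finset X → Timed (Finset X)
  | 0, S => ret S
  | k + 1, S =>
      (oracleH f α ys S τ).bind fun hS =>
      (marginalGains M f α ys S τ hS xs).bind fun cands =>
      (argmaxEntry (tie S) cands).bind fun r =>
      match r with
      | none => ret S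
      | some p =>
          (tick (insert p.1 S)).bind fun S' =>
          greedyRounds M f α ys tie xs τ k S'

/-- The greedy algorithm for fixed `τ`; `xs` lists the ground set, so that `xs.length` rounds
always suffice to exhaust it. -/
noncomputable def greedySet {X Y : Type*} [DecidableEq X] (M : Matroid X)
    (f : Finset X → Y → ℝ) (α : ℝ)
    (ys : List Y) (tie : Finset X → X → X → Bool) (xs : List X) (τ : ℝ) : Timed (Finset X) :=
  greedyRounds M f α ys tie xs τ xs.length ∅

/-- For each index `i` of a list, the pair of `τ_i = i Δ` and its greedy set, together with the
value of `Ĥ` at the pair. -/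
noncomputable def gridPairs {X Y : Type*} [DecidableEq X] (M : Matroid X)
    (f : Finset X → Y → ℝ) (α Δ : ℝ)
    (ys : List Y) (tie : ℝ → Finset X → X → X → Bool) (xs : List X) :
    List ℕ → Timed (List ((Finset X × ℝ) × ℝ))
  | [] => ret []
  | i :: l =>
      (tick ((i : ℝ) * Δ)).bind fun τ =>
      (greedySet M f α ys (tie τ) xs τ).bind fun S =>
      (oracleH f α ys S τ).bind fun h =>
      (gridPairs M f α Δ ys tie xs l).bind fun rest =>
      tick (((S, τ), h) :: rest)

/-- The Sequential Greedy Algorithm: run the greedy algorithm for `τ = i Δ`,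
`i = 0, 1, …, ⌈Γ/Δ⌉`, and return a pair `(S, τ)` of largest value of `Ĥ`.  The rules `tie` and
`tiePair` choose among several maximizers. The list of pairs is never empty, so the default value
is not used. -/
noncomputable def sga {X Y : Type*} [Fintype X] [DecidableEq X] (M : Matroid X)
    (f : Finset X → Y → ℝ) (α Γ Δ : ℝ) (ys : List Y) (tie : ℝ → Finset X → X → X → Bool)
    (tiePair : Finset X × ℝ → Finset X × ℝ → Bool) : Timed (Finset X × ℝ) :=
  (tick (⌈Γ / Δ⌉₊)).bind fun m =>
  (gridPairs M f α Δ ys tie Finset.univ.toList (List.range (m + 1))).bind fun pairs =>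
  (argmaxEntry tiePair pairs).bind fun r =>
  ret (match r with
    | none => (∅, 0)
    | some p => p.1)

end Algorithm

/-!
For fixed `τ` the function `h = H(·, τ)` is monotone and submodular, since truncating a monotone
submodular function at `τ` keeps it so.  Greedy maximization of such an `h` over a matroid loses
only a factor `1 + κ` against any independent set, if the curvature `κ` bounds the marginals
*inside independent sets*: `h S - h (S \ {s}) ≥ (1 - κ) (h {s} - h ∅)`.  To see this, carry an
independent set `I` containing the current greedy set `S`, starting with the competitor.  When the
greedy algorithm adds `g`, exchange `g` for some `o ∈ I \ S` if `I ∪ {g}` is dependent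
(`Matroid.Indep.exists_insert_erase_indep`).  Every set involved stays independent.  The element `o`
contributed at most its gain at `S`, hence at most the gain of `g` there, while `g` contributes at
least `(1 - κ) (h {g} - h ∅)`, which is at least `1 - κ` times that gain.  So each step loses at
most `κ` times the gain of the greedy algorithm (`exists_indep_superset_insert`), and at the end
`I` is the greedy set itself (`greedyRounds_spec`).  A sampling error of `η` costs `2η` per step.
Rounding the optimal `τ` down to the grid costs at most `Δ`, and `H(∅, τ) ≥ -Γ (1/α - 1)` accounts
for `h` not being normalized (`sga_guarantee`).

The sampling error has to be controlled at all grid points `τ = jΔ` at once, whose number is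
unbounded, without a logarithm of that number.  For `v ≥ 0` the shortfall `(jΔ - v)₊` is a sum of
`j` increments with values in `[0, Δ]`, so all deviations at grid points are bounded by the sum of
the absolute deviations of the increments.  The exponential of that sum is, by convexity, at most an
average of exponentials that Hoeffding's lemma controls (`measureReal_le_sum_abs_le`): the
tail bound is that of one variable of range `2Γ`, whatever the grid.  A union bound is needed only
over the `2 ^ |X|` sets (`exists_measurableSet_forall_abs_shortfall_le`).

The running time is obtained by counting the steps of each subroutine (`sga_cost_le`).
-/

/-! ### Greedy steps and matroid exchange -/

section Greedy

variable {X : Type*} [DecidableEq X]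

/-- If `I` and `S ∪ {g}` are independent while `I ∪ {g}` is not, then `g` can be exchanged for
an element of `I` outside `S`: the fundamental circuit of `g` is not contained in `S ∪ {g}`. -/
lemma Matroid.Indep.exists_insert_erase_indep {M : Matroid X} {I S : Finset X} {g : X}
    (hI : M.Indep (I : Set X)) (hgI : g ∉ I)
    (hgS : M.Indep (insert g S : Finset X))
    (hdep : ¬ M.Indep (insert g I : Finset X)) :
    ∃ o ∈ I, o ∉ S ∧ M.Indep (insert g (I.erase o) : Finset X) := by
  have hgE : g ∈ M.E := hgS.subset_ground (by simp)
  have hcl : g ∈ M.closure (I : Set X) := by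
    rw [hI.mem_closure_iff']
    exact ⟨hgE, fun h => absurd (by simpa using h) hdep⟩
  have hgI' : g ∉ (I : Set X) := by simpa using hgI
  have hC := hI.fundCircuit_isCircuit hcl hgI'
  have hnot : ¬ M.fundCircuit g (I : Set X) ⊆ ((insert g S : Finset X) : Set X) :=
    fun hsub => hC.not_indep (hgS.subset hsub)
  obtain ⟨o, hoC, hoS⟩ := Set.not_subset.1 hnot
  have hog : o ≠ g := by rintro rfl; simp at hoS
  have hoI : o ∈ I := by
    have := M.fundCircuit_subset_insert g (I : Set X) hoC
    simpa [hog] using this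
  refine ⟨o, hoI, fun h => hoS (by simp [h]), ?_⟩
  have := (hI.mem_fundCircuit_iff hcl hgI').1 hoC
  refine this.subset fun x hx => ?_
  simp only [Finset.coe_insert, Finset.coe_erase, Set.mem_insert_iff, Set.mem_sdiff,
    Finset.mem_coe, Set.mem_singleton_iff] at hx ⊢
  rcases hx with rfl | hx
  · exact ⟨Or.inl rfl, hog.symm⟩
  · exact ⟨Or.inr hx.1, hx.2⟩

/-- One greedy step.  If `g` has the largest marginal gain at `S` up to `2η`, an independent
set `I ⊇ S` can be changed into an independent set containing `S ∪ {g}`, at a loss of at most `κ`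
times the gain of the step, plus `2η`: the element `o` removed from `I` contributes no more than `g`
does at `S`, and by the curvature bound `g` contributes at least `1 - κ` times its value. -/
lemma exists_indep_superset_insert {M : Matroid X} {h : Finset X → ℝ} {κ η : ℝ}
    (hmono : ∀ S T, S ⊆ T → h S ≤ h T) (hsub : IsSubmodular h)
    (hκ0 : 0 ≤ κ) (hκ1 : κ ≤ 1) (hη : 0 ≤ η)
    (hcurv : ∀ (S : Finset X) s, M.Indep (S : Set X) → s ∈ S →
      (1 - κ) * (h {s} - h ∅) ≤ h S - h (S.erase s))
    {I S : Finset X} {g : X} (hI : M.Indep (I : Set X)) (hSI : S ⊆ I) (hgS : g ∉ S)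
    (hg : M.Indep (insert g S : Finset X))
    (hbest : ∀ o ∉ S, M.Indep (insert o S : Finset X) →
      h (insert o S) ≤ h (insert g S) + 2 * η) :
    ∃ I' : Finset X, M.Indep (I' : Set X) ∧ insert g S ⊆ I' ∧
      h I ≤ h I' + κ * (h (insert g S) - h S) + 2 * η := by
  have hgain : 0 ≤ κ * (h (insert g S) - h S) :=
    mul_nonneg hκ0 (sub_nonneg.2 (hmono _ _ (Finset.subset_insert _ _)))
  by_cases hgI : g ∈ I
  · exact ⟨I, hI, Finset.insert_subset hgI hSI, by linarith⟩
  by_cases hind : M.Indep (insert g I : Finset X)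
  · refine ⟨insert g I, hind, Finset.insert_subset_insert g hSI, ?_⟩
    linarith [hmono I (insert g I) (Finset.subset_insert _ _)]
  obtain ⟨o, hoI, hoS, hI'⟩ := hI.exists_insert_erase_indep hgI hg hind
  have hSJ : S ⊆ I.erase o := fun x hx => Finset.mem_erase.2 ⟨fun e => hoS (e ▸ hx), hSI hx⟩
  refine ⟨insert g (I.erase o), hI', Finset.insert_subset_insert g hSJ, ?_⟩
  have h1 := hsub S (I.erase o) hSJ o (Finset.notMem_erase o I)
  rw [Finset.insert_erase hoI] at h1
  have h2 := hcurv _ g hI' (Finset.mem_insert_self _ _)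
  rw [Finset.erase_insert (fun hm => hgI (Finset.mem_of_mem_erase hm))] at h2
  have h3 := hsub ∅ S (Finset.empty_subset _) g hgS
  rw [insert_empty_eq] at h3
  have h4 := hbest o hoS (hI.subset (by
    intro x hx
    rcases Finset.mem_insert.1 (Finset.mem_coe.1 hx) with rfl | hx
    · exact hoI
    · exact hSI hx))
  nlinarith [mul_le_mul_of_nonneg_left h3 (sub_nonneg.2 hκ1)]

end Greedy

/-! ### The values computed by the algorithm -/

section Values

variable {X Y : Type*}

lemma sumShortfall_val (f : Finset X → Y → ℝ) (S : Finset X) (τ : ℝ) (ys : List Y) :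
    (sumShortfall f S τ ys).val = (ys.map fun y => max (τ - f S y) 0).sum := by
  induction ys with
  | nil => rfl
  | cons y ys ih => simp [sumShortfall, Timed.bind, Timed.tick, ih]

lemma oracleH_val_ofFn (f : Finset X → Y → ℝ) (α : ℝ) {n : ℕ} (ys : Fin n → Y) (S : Finset X)
    (τ : ℝ) : (oracleH f α (List.ofFn ys) S τ).val =
      τ - (∑ i, max (τ - f S (ys i)) 0) / (n * α) := by
  simp [oracleH, Timed.bind, Timed.tick, sumShortfall_val, List.sum_ofFn,
    Function.comp_def]

lemma argmaxEntry_spec {β : Type*} (tie : β → β → Bool) (l : List (β × ℝ)) :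
    match (argmaxEntry tie l).val with
    | none => l = []
    | some p => p ∈ l ∧ ∀ q ∈ l, q.2 ≤ p.2 := by
  induction l with
  | nil => simp [argmaxEntry, Timed.ret]
  | cons p l ih =>
    rcases hr : (argmaxEntry tie l).val with _ | q
    · rw [hr] at ih
      simp only at ih
      subst ih
      simp [argmaxEntry, Timed.bind, Timed.ret]
    · rw [hr] at ih
      simp only at ih
      simp only [argmaxEntry, Timed.bind, hr, Timed.ret, Timed.tick, decide_eq_true_eq]
      split_ifs with hc
      · have hle : q.2 ≤ p.2 := by
          rcases hc with hc | hc
          · exact hc.le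
          · exact hc.1.le
        refine ⟨by simp, fun r hr' => ?_⟩
        rcases List.mem_cons.1 hr' with rfl | hr'
        · exact le_rfl
        · exact (ih.2 r hr').trans hle
      · refine ⟨List.mem_cons_of_mem _ ih.1, fun r hr' => ?_⟩
        rcases List.mem_cons.1 hr' with rfl | hr'
        · exact not_lt.1 fun h => hc (Or.inl h)
        · exact ih.2 r hr'

variable [DecidableEq X]

lemma mem_marginalGains_val (M : Matroid X) (f : Finset X → Y → ℝ) (α : ℝ) (ys : List Y)
    (S : Finset X) (τ hS : ℝ) (l : List X) (p : X × ℝ) :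
    p ∈ (marginalGains M f α ys S τ hS l).val ↔
      p.1 ∈ l ∧ p.1 ∉ S ∧ M.Indep (insert p.1 S : Finset X) ∧
        p.2 = (oracleH f α ys (insert p.1 S) τ).val - hS := by
  induction l with
  | nil => simp [marginalGains, Timed.ret]
  | cons s l ih =>
    by_cases hs : s ∈ S
    · simp only [marginalGains, Timed.bind, Timed.tick, Timed.ret, hs, decide_true, if_true, ih,
        List.mem_cons]
      constructor
      · tauto
      · rintro ⟨rfl | h, h'⟩
        · exact absurd hs h'.1
        · exact ⟨h, h'⟩
    · by_cases hi : M.Indep (insert s S : Finset X)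
      · simp only [marginalGains, Timed.bind, Timed.tick, Timed.ret, hs, decide_false, hi,
          decide_true, if_true, List.mem_cons, ih, Bool.false_eq_true, if_false]
        constructor
        · rintro (rfl | h)
          · exact ⟨Or.inl rfl, hs, hi, rfl⟩
          · tauto
        · rintro ⟨h1 | h1, h2, h3, h4⟩
          · left
            subst h1
            exact Prod.ext rfl h4
          · tauto
      · simp only [marginalGains, Timed.bind, Timed.tick, Timed.ret, hs, decide_false, hi,
          List.mem_cons, ih, Bool.false_eq_true, if_false]
        constructor
        · tauto
        · rintro ⟨h1 | h1, h2, h3, h4⟩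
          · subst h1
            exact absurd h3 hi
          · tauto

lemma indep_greedyRounds_val {M : Matroid X} (f : Finset X → Y → ℝ) (α : ℝ) (ys : List Y)
    (tie : Finset X → X → X → Bool) (xs : List X) (τ : ℝ) (k : ℕ) (S : Finset X)
    (hS : M.Indep (S : Set X)) : M.Indep ((greedyRounds M f α ys tie xs τ k S).val : Set X) := by
  induction k generalizing S with
  | zero => exact hS
  | succ k ih =>
    have hspec := argmaxEntry_spec (tie S)
      (marginalGains M f α ys S τ (oracleH f α ys S τ).val xs).val
    rcases hr : (argmaxEntry (tie S) (marginalGains M f α ys S τ (oracleH f α ys S τ).val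
      xs).val).val with _ | ⟨g, v⟩
    · simpa only [greedyRounds, Timed.bind, hr, Timed.ret] using hS
    · rw [hr] at hspec
      simpa only [greedyRounds, Timed.bind, hr, Timed.tick] using
        ih (insert g S) ((mem_marginalGains_val M f α ys S τ _ _ _).1 hspec.1).2.2.1

/-- The greedy loop against a set function `h` that the sampling oracle approximates up to `η`:
every independent set containing the starting set is nearly covered by the result, up to `κ` times
the total gain and an error of `2η` per round. -/
lemma greedyRounds_spec [Fintype X] {M : Matroid X} {h : Finset X → ℝ} {κ η : ℝ}
    (hmono : ∀ S T, S ⊆ T → h S ≤ h T) (hsub : IsSubmodular h)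
    (hκ0 : 0 ≤ κ) (hκ1 : κ ≤ 1) (hη : 0 ≤ η)
    (hcurv : ∀ (S : Finset X) s, M.Indep (S : Set X) → s ∈ S →
      (1 - κ) * (h {s} - h ∅) ≤ h S - h (S.erase s))
    (f : Finset X → Y → ℝ) (α : ℝ) (ys : List Y) (tie : Finset X → X → X → Bool) (τ : ℝ)
    (happ : ∀ S, |(oracleH f α ys S τ).val - h S| ≤ η)
    (k : ℕ) (S : Finset X) (hS : M.Indep (S : Set X)) (hk : Fintype.card X ≤ S.card + k) :
    ∀ I : Finset X, M.Indep (I : Set X) → S ⊆ I →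
      h I ≤ h (greedyRounds M f α ys tie Finset.univ.toList τ k S).val
        + κ * (h (greedyRounds M f α ys tie Finset.univ.toList τ k S).val - h S)
        + 2 * η * k := by
  induction k generalizing S with
  | zero =>
    intro I _ hSI
    have hIS : S = I := Finset.eq_of_subset_of_card_le hSI ((Finset.card_le_univ I).trans hk)
    simp [greedyRounds, Timed.ret, hIS]
  | succ k ih =>
    have hspec := argmaxEntry_spec (tie S)
      (marginalGains M f α ys S τ (oracleH f α ys S τ).val Finset.univ.toList).val
    rcases hr : (argmaxEntry (tie S) (marginalGains M f α ys S τ (oracleH f α ys S τ).val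
      Finset.univ.toList).val).val with _ | ⟨g, v⟩
    · rw [hr] at hspec
      simp only at hspec
      have hval : (greedyRounds M f α ys tie Finset.univ.toList τ (k + 1) S).val = S := by
        simp only [greedyRounds, Timed.bind, hr, Timed.ret]
      rw [hval]
      intro I hI hSI
      have hIS : I = S := by
        refine Finset.Subset.antisymm (fun s hs => ?_) hSI
        by_contra hsS
        have hmem := (mem_marginalGains_val M f α ys S τ (oracleH f α ys S τ).val
          Finset.univ.toList (s, (oracleH f α ys (insert s S) τ).val -
            (oracleH f α ys S τ).val)).2 ⟨by simp, hsS, hI.subset (by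
              exact_mod_cast Finset.insert_subset hs hSI), rfl⟩
        rw [hspec] at hmem
        simp at hmem
      subst hIS
      have : 0 ≤ 2 * η * ((k + 1 : ℕ) : ℝ) := by positivity
      linarith
    · rw [hr] at hspec
      simp only at hspec
      have hval : (greedyRounds M f α ys tie Finset.univ.toList τ (k + 1) S).val =
          (greedyRounds M f α ys tie Finset.univ.toList τ k (insert g S)).val := by
        simp only [greedyRounds, Timed.bind, hr, Timed.tick]
      rw [hval]
      obtain ⟨-, hgS, hg, hv⟩ := (mem_marginalGains_val M f α ys S τ _ _ _).1 hspec.1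
      simp only at hgS hg hv
      have hbest : ∀ o ∉ S, M.Indep (insert o S : Finset X) →
          h (insert o S) ≤ h (insert g S) + 2 * η := by
        intro o ho hoi
        have hle := hspec.2 (o, (oracleH f α ys (insert o S) τ).val -
            (oracleH f α ys S τ).val) ((mem_marginalGains_val M f α ys S τ _ _ _).2
              ⟨by simp, ho, hoi, rfl⟩)
        simp only at hle
        have h1 := abs_le.1 (happ (insert o S))
        have h2 := abs_le.1 (happ (insert g S))
        linarith
      have hcard : Fintype.card X ≤ (insert g S).card + k := by
        rw [Finset.card_insert_of_notMem hgS]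
        omega
      intro I hI hSI
      obtain ⟨I', hI', hsub', hle⟩ := exists_indep_superset_insert hmono hsub hκ0 hκ1 hη hcurv
        hI hSI hgS hg hbest
      have := ih (insert g S) hg hcard I' hI' hsub'
      push_cast
      linarith

lemma gridPairs_val (M : Matroid X) (f : Finset X → Y → ℝ) (α Δ : ℝ)
    (ys : List Y) (tie : ℝ → Finset X → X → X → Bool) (xs : List X) (l : List ℕ) :
    (gridPairs M f α Δ ys tie xs l).val = l.map fun i : ℕ =>
      (((greedySet M f α ys (tie (i * Δ)) xs (i * Δ)).val, (i : ℝ) * Δ),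
        (oracleH f α ys (greedySet M f α ys (tie (i * Δ)) xs (i * Δ)).val (i * Δ)).val) := by
  induction l with
  | nil => rfl
  | cons i l ih => simp [gridPairs, Timed.bind, Timed.tick, ih]

/-- The output of the algorithm is one of the grid pairs, of largest oracle value. -/
lemma sga_val_spec [Fintype X] (M : Matroid X) (f : Finset X → Y → ℝ) (α Γ Δ : ℝ)
    (ys : List Y) (tie : ℝ → Finset X → X → X → Bool)
    (tiePair : Finset X × ℝ → Finset X × ℝ → Bool) :
    (∃ i : ℕ, i ≤ ⌈Γ / Δ⌉₊ ∧ (sga M f α Γ Δ ys tie tiePair).val =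
      ((greedySet M f α ys (tie (i * Δ)) Finset.univ.toList (i * Δ)).val, (i : ℝ) * Δ)) ∧
    ∀ j : ℕ, j ≤ ⌈Γ / Δ⌉₊ →
      (oracleH f α ys (greedySet M f α ys (tie (j * Δ)) Finset.univ.toList (j * Δ)).val
        (j * Δ)).val ≤ (oracleH f α ys (sga M f α Γ Δ ys tie tiePair).val.1
          (sga M f α Γ Δ ys tie tiePair).val.2).val := by
  have hspec := argmaxEntry_spec tiePair (gridPairs M f α Δ ys tie Finset.univ.toList
    (List.range (⌈Γ / Δ⌉₊ + 1))).val
  rcases hr : (argmaxEntry tiePair (gridPairs M f α Δ ys tie Finset.univ.toList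
    (List.range (⌈Γ / Δ⌉₊ + 1))).val).val with _ | ⟨p, v⟩
  · rw [hr] at hspec
    simp [gridPairs_val] at hspec
  · rw [hr] at hspec
    simp only at hspec
    have hval : (sga M f α Γ Δ ys tie tiePair).val = p := by
      simp only [sga, Timed.bind, Timed.tick, Timed.ret, hr]
    rw [hval]
    rw [gridPairs_val] at hspec
    obtain ⟨i, hi, hp⟩ := List.mem_map.1 hspec.1
    have hp1 := congrArg Prod.fst hp
    have hp2 := congrArg Prod.snd hp
    simp only at hp1 hp2
    refine ⟨⟨i, by simpa [Nat.lt_succ_iff] using hi, hp1.symm⟩, fun j hj => ?_⟩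
    have := hspec.2 _ (List.mem_map.2 ⟨j, by simpa [Nat.lt_succ_iff] using hj, rfl⟩)
    rw [← hp1]
    simp only at this ⊢
    rwa [hp2]

lemma indep_sga_val_fst [Fintype X] (M : Matroid X) (f : Finset X → Y → ℝ) (α Γ Δ : ℝ)
    (ys : List Y) (tie : ℝ → Finset X → X → X → Bool)
    (tiePair : Finset X × ℝ → Finset X × ℝ → Bool) :
    M.Indep ((sga M f α Γ Δ ys tie tiePair).val.1 : Set X) := by
  obtain ⟨⟨i, -, hival⟩, -⟩ := sga_val_spec M f α Γ Δ ys tie tiePair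
  rw [hival]
  exact indep_greedyRounds_val f α ys _ _ _ _ ∅ (by simp)

end Values

/-! ### Running time -/

section Cost

variable {X Y : Type*}

lemma sumShortfall_cost (f : Finset X → Y → ℝ) (S : Finset X) (τ : ℝ) (ys : List Y) :
    (sumShortfall f S τ ys).cost = 4 * ys.length := by
  induction ys with
  | nil => rfl
  | cons y ys ih =>
    simp only [sumShortfall, Timed.bind, Timed.tick, ih, List.length_cons]
    ring

lemma oracleH_cost (f : Finset X → Y → ℝ) (α : ℝ) (ys : List Y) (S : Finset X) (τ : ℝ) :
    (oracleH f α ys S τ).cost = 4 * ys.length + 3 := by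
  simp only [oracleH, Timed.bind, Timed.tick, sumShortfall_cost]

lemma argmaxEntry_cost_le {β : Type*} (tie : β → β → Bool) (l : List (β × ℝ)) :
    (argmaxEntry tie l).cost ≤ l.length := by
  induction l with
  | nil => simp [argmaxEntry, Timed.ret]
  | cons p l ih =>
    rcases hr : (argmaxEntry tie l).val with _ | q <;>
      simp only [argmaxEntry, Timed.bind, hr, Timed.ret, Timed.tick, List.length_cons] <;> omega

variable [DecidableEq X]

lemma marginalGains_length_cost_le (M : Matroid X) (f : Finset X → Y → ℝ) (α : ℝ) (ys : List Y)
    (S : Finset X) (τ hS : ℝ) (l : List X) :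
    (marginalGains M f α ys S τ hS l).val.length ≤ l.length ∧
      (marginalGains M f α ys S τ hS l).cost ≤ l.length * (4 * ys.length + 8) := by
  induction l with
  | nil => simp [marginalGains, Timed.ret]
  | cons s l ih =>
    obtain ⟨ih1, ih2⟩ := ih
    by_cases hs : s ∈ S <;> by_cases hi : M.Indep (insert s S : Finset X) <;>
      simp only [marginalGains, Timed.bind, Timed.tick, Timed.ret, hs, hi, decide_true,
        decide_false, if_true, if_false, Bool.false_eq_true, List.length_cons, oracleH_cost] <;>
      constructor <;> first | omega | (rw [Nat.succ_mul l.length]; omega)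

lemma greedyRounds_cost_le (M : Matroid X) (f : Finset X → Y → ℝ) (α : ℝ) (ys : List Y)
    (tie : Finset X → X → X → Bool) (xs : List X) (τ : ℝ) (k : ℕ) (S : Finset X) :
    (greedyRounds M f α ys tie xs τ k S).cost ≤
      k * (4 * ys.length + 4 + xs.length * (4 * ys.length + 9)) := by
  induction k generalizing S with
  | zero => simp [greedyRounds, Timed.ret]
  | succ k ih =>
    obtain ⟨hlen, hcost⟩ := marginalGains_length_cost_le M f α ys S τ (oracleH f α ys S τ).val xs
    have harg := argmaxEntry_cost_le (tie S)
      (marginalGains M f α ys S τ (oracleH f α ys S τ).val xs).val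
    have hsplit : xs.length * (4 * ys.length + 9) =
      xs.length * (4 * ys.length + 8) + xs.length := by ring
    rw [Nat.succ_mul]
    rcases hr : (argmaxEntry (tie S) (marginalGains M f α ys S τ (oracleH f α ys S τ).val
      xs).val).val with _ | ⟨g, v⟩
    · simp only [greedyRounds, Timed.bind, hr, Timed.ret, oracleH_cost]
      omega
    · have := ih (insert g S)
      simp only [greedyRounds, Timed.bind, hr, Timed.tick, oracleH_cost]
      omega

lemma gridPairs_cost_le (M : Matroid X) (f : Finset X → Y → ℝ) (α Δ : ℝ)
    (ys : List Y) (tie : ℝ → Finset X → X → X → Bool) (xs : List X) (l : List ℕ) :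
    (gridPairs M f α Δ ys tie xs l).cost ≤ l.length *
      (xs.length * (4 * ys.length + 4 + xs.length * (4 * ys.length + 9))
        + (4 * ys.length + 5)) := by
  induction l with
  | nil => simp [gridPairs, Timed.ret]
  | cons i l ih =>
    have := greedyRounds_cost_le M f α ys (tie (i * Δ)) xs (i * Δ) xs.length ∅
    simp only [gridPairs, greedySet, Timed.bind, Timed.tick, oracleH_cost, List.length_cons]
    rw [Nat.succ_mul l.length]
    omega

lemma sga_cost_le [Fintype X] [Nonempty X] (M : Matroid X) (f : Finset X → Y → ℝ) {α Γ Δ : ℝ}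
    (hΓ : 0 < Γ) (hΔ : 0 < Δ) {ys : List Y} (hys : 0 < ys.length)
    (tie : ℝ → Finset X → X → X → Bool) (tiePair : Finset X × ℝ → Finset X × ℝ → Bool) :
    (sga M f α Γ Δ ys tie tiePair).cost ≤
      63 * (⌈Γ / Δ⌉₊ * Fintype.card X ^ 2 * ys.length) := by
  have hm : 1 ≤ ⌈Γ / Δ⌉₊ := Nat.ceil_pos.2 (div_pos hΓ hΔ)
  have hN : 1 ≤ Fintype.card X := Fintype.card_pos
  have h1 := gridPairs_cost_le M f α Δ ys tie (Finset.univ : Finset X).toList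
    (List.range (⌈Γ / Δ⌉₊ + 1))
  have h2 := argmaxEntry_cost_le tiePair (gridPairs M f α Δ ys tie (Finset.univ : Finset X).toList
    (List.range (⌈Γ / Δ⌉₊ + 1))).val
  rw [gridPairs_val, List.length_map, List.length_range, ← gridPairs_val] at h2
  rw [List.length_range, Finset.length_toList, Finset.card_univ] at h1
  have hcost : (sga M f α Γ Δ ys tie tiePair).cost ≤ 1 + (⌈Γ / Δ⌉₊ + 1) *
      (Fintype.card X * (4 * ys.length + 4 + Fintype.card X * (4 * ys.length + 9))
        + (4 * ys.length + 5)) + (⌈Γ / Δ⌉₊ + 1) := by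
    simp only [sga, Timed.bind, Timed.tick, Timed.ret]
    omega
  refine hcost.trans ?_
  generalize ⌈Γ / Δ⌉₊ = m at *
  generalize Fintype.card X = N at *
  generalize ys.length = n at *
  have hNN : N ≤ N ^ 2 := by nlinarith
  have hB : N * (4 * n + 4 + N * (4 * n + 9)) + (4 * n + 5) ≤ 30 * (N ^ 2 * n) := by
    have e1 : N ≤ N ^ 2 * n := by nlinarith
    have e2 : N * n ≤ N ^ 2 * n := Nat.mul_le_mul_right _ hNN
    have e3 : n ≤ N ^ 2 * n := by nlinarith
    have e4 : N ^ 2 ≤ N ^ 2 * n := Nat.le_mul_of_pos_right _ hys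
    have e5 : 1 ≤ N ^ 2 * n := by omega
    nlinarith
  have hQ : 1 ≤ N ^ 2 * n := Nat.mul_pos (by positivity) hys
  calc 1 + (m + 1) * (N * (4 * n + 4 + N * (4 * n + 9)) + (4 * n + 5)) + (m + 1)
      ≤ 1 + (m + 1) * (30 * (N ^ 2 * n)) + (m + 1) := by gcongr
    _ ≤ 63 * (m * (N ^ 2 * n)) := by
      have : m ≤ m * (N ^ 2 * n) := Nat.le_mul_of_pos_right _ hQ
      have : N ^ 2 * n ≤ m * (N ^ 2 * n) := Nat.le_mul_of_pos_left _ hm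
      nlinarith
    _ = 63 * (m * N ^ 2 * n) := by ring

end Cost

/-! ### Concentration -/

section Concentration

open ProbabilityTheory
open scoped NNReal

/-- Tail bound for a sum of absolute values of sub-Gaussian variables that need not be independent.
By convexity the exponential of the sum is at most an average of exponentials of single terms, so
the bound is that for one variable of the size of the whole sum, without a union bound. -/
lemma measureReal_le_sum_abs_le {Ω ι : Type*} [MeasurableSpace Ω] {μ : Measure Ω}
    {s : Finset ι} (hs : s.Nonempty)
    {Z : ι → Ω → ℝ} {c : ℝ≥0} (hc : 0 < c) (hZ : ∀ k ∈ s, HasSubgaussianMGF (Z k) c μ)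
    {t : ℝ} (ht : 0 ≤ t) :
    μ.real {ω | t ≤ ∑ k ∈ s, |Z k ω|} ≤
      2 * Real.exp (-t ^ 2 / (2 * (s.card : ℝ) ^ 2 * c)) := by
  have hm : (0 : ℝ) < (s.card : ℝ) := Nat.cast_pos.2 hs.card_pos
  have hc' : (0 : ℝ) < c := by exact_mod_cast hc
  set m : ℝ := (s.card : ℝ) with hmdef
  -- The minimizer over `l` of the exponent `m ^ 2 * c * l ^ 2 / 2 - l * t`.
  set l : ℝ := t / (m ^ 2 * c) with hl
  have hl0 : 0 ≤ l := by positivity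
  set G : Ω → ℝ := fun ω => ∑ k ∈ s, m⁻¹ *
    (Real.exp ((l * m) * Z k ω) + Real.exp ((-(l * m)) * Z k ω)) with hG
  have hint : ∀ k ∈ s, Integrable (fun ω => m⁻¹ *
      (Real.exp ((l * m) * Z k ω) + Real.exp ((-(l * m)) * Z k ω))) μ := fun k hk =>
    (((hZ k hk).integrable_exp_mul _).add ((hZ k hk).integrable_exp_mul _)).const_mul _
  have hGint : Integrable G μ := integrable_finsetSum _ hint
  have hGle : ∀ ω, Real.exp (l * ∑ k ∈ s, |Z k ω|) ≤ G ω := by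
    intro ω
    have hj := convexOn_exp.map_sum_le (t := s) (w := fun _ => m⁻¹)
      (p := fun k => (l * m) * |Z k ω|) (fun _ _ => by positivity)
      (by simp [← hmdef, hm.ne']) (fun _ _ => Set.mem_univ _)
    simp only [smul_eq_mul] at hj
    have heq : ∑ k ∈ s, m⁻¹ * (l * m * |Z k ω|) = l * ∑ k ∈ s, |Z k ω| := by
      rw [Finset.mul_sum]
      refine Finset.sum_congr rfl fun k _ => ?_
      field_simp
    rw [heq] at hj
    refine hj.trans (Finset.sum_le_sum fun k _ => ?_)
    refine mul_le_mul_of_nonneg_left ?_ (by positivity)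
    rcases abs_cases (Z k ω) with ⟨h, -⟩ | ⟨h, -⟩ <;> rw [h]
    · linarith [Real.exp_pos ((-(l * m)) * Z k ω)]
    · have : l * m * -Z k ω = (-(l * m)) * Z k ω := by ring
      rw [this]
      linarith [Real.exp_pos ((l * m) * Z k ω)]
  have hGi : ∫ ω, G ω ∂μ ≤ 2 * Real.exp (c * (l * m) ^ 2 / 2) := by
    rw [hG, integral_finsetSum _ hint]
    calc _ ≤ ∑ k ∈ s, m⁻¹ * (2 * Real.exp (c * (l * m) ^ 2 / 2)) := by
          refine Finset.sum_le_sum fun k hk => ?_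
          rw [integral_const_mul, integral_add ((hZ k hk).integrable_exp_mul _)
            ((hZ k hk).integrable_exp_mul _)]
          refine mul_le_mul_of_nonneg_left ?_ (by positivity)
          have h1 := (hZ k hk).mgf_le (l * m)
          have h2 := (hZ k hk).mgf_le (-(l * m))
          rw [neg_sq] at h2
          simp only [mgf] at h1 h2
          linarith
      _ = _ := by
          rw [Finset.sum_const, nsmul_eq_mul, ← hmdef]
          field_simp
  have hmarkov := mul_meas_ge_le_integral_of_nonneg (μ := μ)
    (ae_of_all _ fun ω => (Real.exp_pos _).le.trans (hGle ω)) hGint (Real.exp (l * t))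
  have hmono : μ.real {ω | t ≤ ∑ k ∈ s, |Z k ω|} ≤ μ.real {ω | Real.exp (l * t) ≤ G ω} := by
    refine ENNReal.toReal_mono ?_ (measure_mono fun ω hω => ?_)
    · exact (hGint.measure_ge_lt_top (Real.exp_pos _)).ne
    · exact (Real.exp_le_exp.2 (mul_le_mul_of_nonneg_left hω hl0)).trans (hGle ω)
  have hfin : μ.real {ω | Real.exp (l * t) ≤ G ω} ≤
      2 * Real.exp (c * (l * m) ^ 2 / 2) / Real.exp (l * t) := by
    rw [le_div_iff₀ (Real.exp_pos _), mul_comm]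
    exact hmarkov.trans hGi
  refine (hmono.trans hfin).trans (le_of_eq ?_)
  rw [mul_div_assoc, ← Real.exp_sub]
  congr 2
  rw [hl]
  field_simp
  ring

/-- The increment of `v ↦ (τ - v)₊` between the consecutive grid points `τ = kΔ` and
`τ = (k + 1)Δ`. -/
noncomputable def shortfallIncrement (Δ : ℝ) (k : ℕ) (v : ℝ) : ℝ :=
  max ((k + 1 : ℕ) * Δ - v) 0 - max ((k : ℝ) * Δ - v) 0

lemma shortfallIncrement_mem_Icc {Δ : ℝ} (hΔ : 0 ≤ Δ) (k : ℕ) (v : ℝ) :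
    shortfallIncrement Δ k v ∈ Set.Icc 0 Δ := by
  unfold shortfallIncrement
  push_cast
  constructor
  · rw [sub_nonneg]
    exact max_le_max_right _ (by nlinarith)
  · rw [sub_le_iff_le_add]
    refine max_le ?_ (add_nonneg hΔ (le_max_right _ _))
    linarith [le_max_left ((k : ℝ) * Δ - v) 0]

lemma sum_shortfallIncrement {Δ : ℝ} (j : ℕ) {v : ℝ} (hv : 0 ≤ v) :
    ∑ k ∈ Finset.range j, shortfallIncrement Δ k v = max (j * Δ - v) 0 := by
  unfold shortfallIncrement
  rw [Finset.sum_range_sub (fun k : ℕ => max ((k : ℝ) * Δ - v) 0)]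
  simp [hv]

variable {Y : Type*} [MeasurableSpace Y] {ν : Measure Y}

lemma aemeasurable_shortfallIncrement {g : Y → ℝ} (hg : AEMeasurable g ν) (Δ : ℝ) (k : ℕ) :
    AEMeasurable (fun y => shortfallIncrement Δ k (g y)) ν :=
  ((hg.const_sub _).max aemeasurable_const).sub ((hg.const_sub _).max aemeasurable_const)

variable [IsProbabilityMeasure ν]

lemma integrable_shortfallIncrement {g : Y → ℝ} (hg : AEMeasurable g ν) {Δ : ℝ} (hΔ : 0 ≤ Δ)
    (k : ℕ) : Integrable (fun y => shortfallIncrement Δ k (g y)) ν :=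
  Integrable.of_mem_Icc 0 Δ (aemeasurable_shortfallIncrement hg Δ k)
    (ae_of_all _ fun _ => shortfallIncrement_mem_Icc hΔ k _)

/-- The deviation of the `k`-th increment from its mean, summed over a sample. -/
noncomputable def incrementDeviation (ν : Measure Y) (g : Y → ℝ) (Δ : ℝ) {n : ℕ} (k : ℕ)
    (ys : Fin n → Y) : ℝ :=
  ∑ i, (shortfallIncrement Δ k (g (ys i)) - ∫ y, shortfallIncrement Δ k (g y) ∂ν)

/-- Hoeffding's lemma, summed over the sample. -/
lemma hasSubgaussianMGF_incrementDeviation {g : Y → ℝ} (hg : AEMeasurable g ν) {Δ : ℝ≥0}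
    (n k : ℕ) :
    HasSubgaussianMGF (incrementDeviation ν g Δ (n := n) k) (n * (Δ / 2) ^ 2)
      (Measure.pi fun _ : Fin n => ν) := by
  have hmeas := aemeasurable_shortfallIncrement hg Δ k
  have h0 := hasSubgaussianMGF_of_mem_Icc hmeas
    (ae_of_all _ fun y => shortfallIncrement_mem_Icc Δ.2 k (g y))
  have hind : iIndepFun (fun (i : Fin n) (ys : Fin n → Y) =>
      shortfallIncrement Δ k (g (ys i)) - ∫ y, shortfallIncrement Δ k (g y) ∂ν)
      (Measure.pi fun _ : Fin n => ν) :=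
    iIndepFun_pi (X := fun _ y => shortfallIncrement Δ k (g y) -
      ∫ y, shortfallIncrement Δ k (g y) ∂ν) fun _ => hmeas.sub_const _
  have hi : ∀ i ∈ (Finset.univ : Finset (Fin n)), HasSubgaussianMGF (fun ys : Fin n → Y =>
      shortfallIncrement Δ k (g (ys i)) - ∫ y, shortfallIncrement Δ k (g y) ∂ν) ((Δ / 2) ^ 2)
      (Measure.pi fun _ : Fin n => ν) := by
    intro i _
    have hmp := measurePreserving_eval (fun _ : Fin n => ν) i
    have h1 : HasSubgaussianMGF (fun y => shortfallIncrement Δ k (g y) -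
        ∫ y, shortfallIncrement Δ k (g y) ∂ν) ((Δ / 2) ^ 2)
        ((Measure.pi fun _ : Fin n => ν).map (Function.eval i)) := by
      rw [hmp.map_eq]
      simpa using h0
    exact HasSubgaussianMGF.of_map hmp.aemeasurable h1
  have := HasSubgaussianMGF.sum_of_iIndepFun hind hi
  rwa [Finset.sum_const, Finset.card_univ, Fintype.card_fin, nsmul_eq_mul] at this

/-- Up to the factor `n`, the deviation of the empirical mean of `(jΔ - g)₊` from its expectation
is a sum of increment deviations. -/
lemma sum_shortfall_sub_eq {g : Y → ℝ} (hg : AEMeasurable g ν) (hg0 : ∀ y, 0 ≤ g y) {Δ : ℝ}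
    (hΔ : 0 ≤ Δ) {n : ℕ} (ys : Fin n → Y) (j : ℕ) :
    (∑ i, max (j * Δ - g (ys i)) 0) - n * ∫ y, max (j * Δ - g y) 0 ∂ν =
      ∑ k ∈ Finset.range j, incrementDeviation ν g Δ k ys := by
  have h1 : ∫ y, max (j * Δ - g y) 0 ∂ν =
      ∑ k ∈ Finset.range j, ∫ y, shortfallIncrement Δ k (g y) ∂ν := by
    rw [← integral_finsetSum _ fun k _ => integrable_shortfallIncrement hg hΔ k]
    exact integral_congr_ae (ae_of_all _ fun y => (sum_shortfallIncrement j (hg0 y)).symm)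
  simp only [incrementDeviation, Finset.sum_sub_distrib, Finset.sum_const, Finset.card_univ,
    Fintype.card_fin, nsmul_eq_mul]
  rw [Finset.sum_comm, h1, Finset.mul_sum]
  simp_rw [sum_shortfallIncrement j (hg0 _)]

/-- Uniform concentration on the grid: outside an event of probability at most `δ`, the empirical
means of the shortfalls `(jΔ - g s)₊`, for all `s` and all grid points `jΔ`, are within `θ` of their
expectations.  The number of grid points enters only through the range `mΔ ≤ L`. -/
lemma exists_measurableSet_forall_abs_shortfall_le {ι : Type*} [Fintype ι] {g : ι → Y → ℝ}
    (hg : ∀ s, AEMeasurable (g s) ν) (hg0 : ∀ s y, 0 ≤ g s y) {Δ L θ δ : ℝ} (hΔ : 0 < Δ)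
    {m n : ℕ} (hm : 0 < m) (hn : 0 < n) (hL : m * Δ ≤ L) (hθ : 0 < θ)
    (hδ : Fintype.card ι * (2 * Real.exp (-(2 * n * θ ^ 2 / L ^ 2))) ≤ δ) :
    ∃ A : Set (Fin n → Y), MeasurableSet A ∧
      ENNReal.ofReal (1 - δ) ≤ Measure.pi (fun _ : Fin n => ν) A ∧
      ∀ ys ∈ A, ∀ s, ∀ j ≤ m,
        |(∑ i, max (j * Δ - g s (ys i)) 0) / n - ∫ y, max (j * Δ - g s y) 0 ∂ν| ≤ θ := by
  set μ := Measure.pi (fun _ : Fin n => ν) with hμ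
  have hn' : (0 : ℝ) < n := by exact_mod_cast hn
  have hm' : (0 : ℝ) < m := by exact_mod_cast hm
  have hmΔ : 0 < m * Δ := mul_pos hm' hΔ
  set B : ι → Set (Fin n → Y) := fun s =>
    {ys | n * θ ≤ ∑ k ∈ Finset.range m, |incrementDeviation ν (g s) Δ k ys|} with hB
  have hBs : ∀ s, μ.real (B s) ≤ 2 * Real.exp (-(2 * n * θ ^ 2 / L ^ 2)) := by
    intro s
    have hc : (0 : ℝ≥0) < n * (Δ.toNNReal / 2) ^ 2 := by
      have : 0 < Δ.toNNReal := Real.toNNReal_pos.2 hΔ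
      positivity
    have hle := measureReal_le_sum_abs_le (μ := μ) (s := Finset.range m) (t := n * θ)
      (Finset.nonempty_range_iff.2 hm.ne') hc
      (fun k _ => hasSubgaussianMGF_incrementDeviation (hg s) (Δ := Δ.toNNReal) n k)
      (by positivity)
    rw [Real.coe_toNNReal _ hΔ.le] at hle
    refine hle.trans ?_
    gcongr 2 * Real.exp ?_
    rw [Finset.card_range]
    push_cast
    rw [Real.coe_toNNReal _ hΔ.le, neg_div]
    refine neg_le_neg ?_
    have heq : (n * θ) ^ 2 / (2 * (m : ℝ) ^ 2 * (n * (Δ / 2) ^ 2)) =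
        2 * n * θ ^ 2 / (m * Δ) ^ 2 := by
      field_simp
    rw [heq]
    gcongr
  have hBU : μ.real (⋃ s, B s) ≤ δ := by
    refine (measureReal_iUnion_fintype_le B).trans ((Finset.sum_le_sum fun s _ => hBs s).trans ?_)
    simpa [Finset.sum_const, nsmul_eq_mul] using hδ
  refine ⟨(toMeasurable μ (⋃ s, B s))ᶜ, (measurableSet_toMeasurable _ _).compl, ?_, ?_⟩
  · rw [prob_compl_eq_one_sub (measurableSet_toMeasurable _ _), measure_toMeasurable,
      ENNReal.ofReal_sub _ (measureReal_nonneg.trans hBU), ENNReal.ofReal_one]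
    refine tsub_le_tsub_left ?_ _
    rw [← ofReal_measureReal]
    exact ENNReal.ofReal_le_ofReal hBU
  · intro ys hys s j hj
    have hys' : ys ∉ B s := fun h =>
      hys (subset_toMeasurable _ _ (Set.mem_iUnion.2 ⟨s, h⟩))
    have hlt : ∑ k ∈ Finset.range m, |incrementDeviation ν (g s) Δ k ys| < n * θ :=
      not_le.1 hys'
    have heq := sum_shortfall_sub_eq (hg s) (hg0 s) hΔ.le ys j
    have habs : |(∑ i, max (j * Δ - g s (ys i)) 0) - n * ∫ y, max (j * Δ - g s y) 0 ∂ν|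
        ≤ n * θ := by
      rw [heq]
      refine (Finset.abs_sum_le_sum_abs _ _).trans (le_trans ?_ hlt.le)
      exact Finset.sum_le_sum_of_subset_of_nonneg (Finset.range_mono hj)
        fun _ _ _ => abs_nonneg _
    have hdiv : (∑ i, max (j * Δ - g s (ys i)) 0) / n - ∫ y, max (j * Δ - g s y) 0 ∂ν =
        ((∑ i, max (j * Δ - g s (ys i)) 0) - n * ∫ y, max (j * Δ - g s y) 0 ∂ν) / n := by
      field_simp
    rw [hdiv, abs_div, abs_of_pos hn', div_le_iff₀ hn', mul_comm θ]
    exact habs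

end Concentration

/-! ### The auxiliary function and its curvature -/

section AuxiliaryFunction

variable {X Y : Type*}

section Basic

variable [MeasurableSpace Y] {ν : Measure Y} [IsProbabilityMeasure ν]

lemma integrable_shortfall {g : Y → ℝ} (hg : AEMeasurable g ν) (hg0 : ∀ y, 0 ≤ g y) (τ : ℝ) :
    Integrable (fun y => max (τ - g y) 0) ν :=
  Integrable.of_mem_Icc 0 (max τ 0) ((hg.const_sub τ).max aemeasurable_const)
    (ae_of_all _ fun y => ⟨le_max_right _ _, max_le_max_right _ (by linarith [hg0 y])⟩)

lemma auxH_empty {f : Finset X → Y → ℝ} (hf0 : ∀ y, f ∅ y = 0) (α : ℝ) {τ : ℝ} (hτ : 0 ≤ τ) :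
    auxH ν f α ∅ τ = -(τ * (1 / α - 1)) := by
  simp only [auxH, hf0, sub_zero, max_eq_left hτ, integral_const, probReal_univ, one_smul]
  ring

lemma auxH_mono {f : Finset X → Y → ℝ} (hmeas : ∀ S, AEMeasurable (f S) ν)
    (hnn : ∀ S y, 0 ≤ f S y) (hmono : ∀ y S T, S ⊆ T → f S y ≤ f T y) {α : ℝ} (hα : 0 < α) (τ : ℝ)
    (S T : Finset X) (hST : S ⊆ T) : auxH ν f α S τ ≤ auxH ν f α T τ := by
  unfold auxH
  gcongr ?_ - ?_ * ?_
  exact integral_mono (integrable_shortfall (hmeas T) (hnn T) τ)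
    (integrable_shortfall (hmeas S) (hnn S) τ)
    fun y => max_le_max_right _ (by linarith [hmono y S T hST])

/-- Lowering `τ` by `d` lowers the auxiliary function by at most `d`. -/
lemma auxH_sub_le {g : Finset X → Y → ℝ} (hmeas : ∀ S, AEMeasurable (g S) ν)
    (hnn : ∀ S y, 0 ≤ g S y) {α : ℝ} (hα : 0 < α) (S : Finset X) {σ τ : ℝ} (hστ : σ ≤ τ) :
    auxH ν g α S τ - (τ - σ) ≤ auxH ν g α S σ := by
  have h : ∫ y, max (σ - g S y) 0 ∂ν ≤ ∫ y, max (τ - g S y) 0 ∂ν :=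
    integral_mono (integrable_shortfall (hmeas S) (hnn S) σ)
      (integrable_shortfall (hmeas S) (hnn S) τ)
      fun y => max_le_max_right _ (by linarith)
  have h' := mul_le_mul_of_nonneg_left h (one_div_pos.2 hα).le
  simp only [auxH]
  linarith

end Basic

variable [DecidableEq X]

lemma zero_mem_lowerBounds_curvatureRatios {M : Matroid X} {h : Finset X → ℝ}
    (hmono : ∀ S T, S ⊆ T → h S ≤ h T) :
    (0 : ℝ) ∈ lowerBounds (insert 1 (curvatureRatios M h)) := by
  rintro r (rfl | ⟨S, s, -, -, -, rfl⟩)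
  · exact zero_le_one
  · exact div_nonneg (sub_nonneg.2 (hmono _ _ (Finset.erase_subset _ _)))
      (sub_nonneg.2 (hmono _ _ (Finset.empty_subset _)))

lemma curvature_mem_Icc {M : Matroid X} {h : Finset X → ℝ}
    (hmono : ∀ S T, S ⊆ T → h S ≤ h T) : curvature M h ∈ Set.Icc 0 1 := by
  have hlb := zero_mem_lowerBounds_curvatureRatios (M := M) hmono
  have h0 : 0 ≤ sInf (insert 1 (curvatureRatios M h)) :=
    le_csInf ⟨1, Set.mem_insert _ _⟩ fun r hr => hlb hr
  have h1 : sInf (insert 1 (curvatureRatios M h)) ≤ 1 := csInf_le ⟨0, hlb⟩ (Set.mem_insert _ _)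
  unfold curvature
  constructor <;> linarith

lemma one_sub_curvature_mul_le {M : Matroid X} {h : Finset X → ℝ}
    (hmono : ∀ S T, S ⊆ T → h S ≤ h T) {S : Finset X} {s : X} (hS : M.Indep (S : Set X))
    (hs : s ∈ S) : (1 - curvature M h) * (h {s} - h ∅) ≤ h S - h (S.erase s) := by
  have hnum : 0 ≤ h S - h (S.erase s) := sub_nonneg.2 (hmono _ _ (Finset.erase_subset _ _))
  by_cases hne : h {s} = h ∅
  · simpa [hne] using hnum
  have hpos : 0 < h {s} - h ∅ :=
    sub_pos.2 (lt_of_le_of_ne (hmono _ _ (Finset.empty_subset _)) (Ne.symm hne))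
  have hle : sInf (insert 1 (curvatureRatios M h)) ≤ (h S - h (S.erase s)) / (h {s} - h ∅) :=
    csInf_le ⟨0, zero_mem_lowerBounds_curvatureRatios hmono⟩
      (Set.mem_insert_of_mem _ ⟨S, s, hS, hs, hne, rfl⟩)
  rw [le_div_iff₀ hpos] at hle
  simpa [curvature] using hle

/-- Truncating a monotone submodular function from above, here written through the shortfall
`(τ - g)₊ = τ - min τ g`, keeps it submodular. -/
lemma IsSubmodular.neg_max_sub {g : Finset X → ℝ} (hg : IsSubmodular g)
    (hmono : ∀ S T, S ⊆ T → g S ≤ g T) (τ : ℝ) : IsSubmodular fun S => -max (τ - g S) 0 := by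
  intro S T hST s hs
  have h1 := hg S T hST s hs
  have h2 := hmono S T hST
  have h3 := hmono S (insert s S) (Finset.subset_insert _ _)
  have h4 := hmono T (insert s T) (Finset.subset_insert _ _)
  have h5 := hmono (insert s S) (insert s T) (Finset.insert_subset_insert _ hST)
  simp only
  rcases max_cases (τ - g (insert s T)) 0 with ⟨e1, _⟩ | ⟨e1, _⟩ <;>
  rcases max_cases (τ - g T) 0 with ⟨e2, _⟩ | ⟨e2, _⟩ <;>
  rcases max_cases (τ - g (insert s S)) 0 with ⟨e3, _⟩ | ⟨e3, _⟩ <;>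
  rcases max_cases (τ - g S) 0 with ⟨e4, _⟩ | ⟨e4, _⟩ <;>
  rw [e1, e2, e3, e4] <;> linarith

variable [MeasurableSpace Y] {ν : Measure Y} {f : Finset X → Y → ℝ} {α : ℝ}

lemma auxCurvature_mem_Icc {M : Matroid X} {Γ : ℝ} (hΓ : 0 ≤ Γ)
    (hH : ∀ τ, ∀ S T : Finset X, S ⊆ T → auxH ν f α S τ ≤ auxH ν f α T τ) :
    auxCurvature M ν f α Γ ∈ Set.Icc 0 1 := by
  have hub : ∀ r ∈ (fun τ => curvature M (fun S => auxH ν f α S τ)) '' Set.Icc 0 Γ, r ≤ 1 := by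
    rintro r ⟨τ, -, rfl⟩
    exact (curvature_mem_Icc (hH τ)).2
  refine ⟨le_csSup_of_le ⟨1, hub⟩ ⟨0, ⟨le_rfl, hΓ⟩, rfl⟩ (curvature_mem_Icc (hH 0)).1,
    csSup_le ⟨_, ⟨0, ⟨le_rfl, hΓ⟩, rfl⟩⟩ hub⟩

lemma curvature_le_auxCurvature {M : Matroid X} {Γ : ℝ}
    (hH : ∀ τ, ∀ S T : Finset X, S ⊆ T → auxH ν f α S τ ≤ auxH ν f α T τ) {τ : ℝ}
    (hτ : τ ∈ Set.Icc 0 Γ) :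
    curvature M (fun S => auxH ν f α S τ) ≤ auxCurvature M ν f α Γ := by
  refine le_csSup ⟨1, ?_⟩ ⟨τ, hτ, rfl⟩
  rintro r ⟨τ, -, rfl⟩
  exact (curvature_mem_Icc (hH τ)).2

lemma isSubmodular_auxH [IsProbabilityMeasure ν] (hmeas : ∀ S, AEMeasurable (f S) ν)
    (hnn : ∀ S y, 0 ≤ f S y) (hmono : ∀ y S T, S ⊆ T → f S y ≤ f T y)
    (hsub : ∀ y, IsSubmodular fun S => f S y) (hα : 0 < α) (τ : ℝ) :
    IsSubmodular fun S => auxH ν f α S τ := by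
  intro S T hST s hs
  have hint := fun S => integrable_shortfall (hmeas S) (hnn S) τ
  have h := integral_mono ((hint T).add (hint (insert s S)))
    ((hint S).add (hint (insert s T))) fun y => by
      have := (hsub y).neg_max_sub (hmono y) τ S T hST s hs
      simp only [Pi.add_apply] at this ⊢
      linarith
  simp only [Pi.add_apply] at h
  rw [integral_add (hint T) (hint _), integral_add (hint S) (hint _)] at h
  have h' := mul_le_mul_of_nonneg_left h (one_div_pos.2 hα).le
  simp only [auxH]
  linarith

end AuxiliaryFunction

/-! ### The approximation guarantee -/

section Guarantee

variable {X Y : Type*} [Fintype X] [DecidableEq X]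
  [MeasurableSpace Y] {ν : Measure Y} [IsProbabilityMeasure ν] {M : Matroid X}
  {f : Finset X → Y → ℝ} {α Γ Δ : ℝ}

/-- The guarantee for fixed samples on which the sampling oracle is accurate up to `η` at the grid
points.  The grid point just below `τ` costs at most `Δ`; the errors of the at most `|X|` greedy
rounds and of the final comparison add up to `2η(|X| + 1) ≤ 4η|X|`. -/
lemma sga_guarantee [Nonempty X] (hmeas : ∀ S, AEMeasurable (f S) ν)
    (hnn : ∀ S y, 0 ≤ f S y) (hf0 : ∀ y, f ∅ y = 0)
    (hmono : ∀ y S T, S ⊆ T → f S y ≤ f T y) (hsub : ∀ y, IsSubmodular fun S => f S y)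
    (hα : 0 < α) (hα1 : α ≤ 1) (hΓ : 0 < Γ) (hΔ : 0 < Δ) {η : ℝ} (hη : 0 ≤ η) {ys : List Y}
    (happ : ∀ S, ∀ j ≤ ⌈Γ / Δ⌉₊,
      |(oracleH f α ys S (j * Δ)).val - auxH ν f α S (j * Δ)| ≤ η)
    (tie : ℝ → Finset X → X → X → Bool) (tiePair : Finset X × ℝ → Finset X × ℝ → Bool)
    {S : Finset X} {τ : ℝ} (hS : M.Indep (S : Set X)) (hτ : τ ∈ Set.Icc 0 Γ) :
    1 / (1 + auxCurvature M ν f α Γ) * (auxH ν f α S τ - Δ)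
      - auxCurvature M ν f α Γ / (1 + auxCurvature M ν f α Γ) * Γ * (1 / α - 1)
      - 4 * η * Fintype.card X ≤
    auxH ν f α (sga M f α Γ Δ ys tie tiePair).val.1 (sga M f α Γ Δ ys tie tiePair).val.2 := by
  have hH := auxH_mono hmeas hnn hmono hα
  obtain ⟨hκ0, hκ1⟩ := auxCurvature_mem_Icc (M := M) hΓ.le hH
  set κ := auxCurvature M ν f α Γ with hκ
  -- `jΔ` is the largest grid point not above `τ`; it lies in `[0, Γ]`, where the curvature is
  -- taken, although the returned pair may use a grid point above `Γ`.
  set j := ⌊τ / Δ⌋₊ with hj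
  have hjτ : j * Δ ≤ τ := by
    rw [← le_div_iff₀ hΔ]
    exact Nat.floor_le (div_nonneg hτ.1 hΔ.le)
  have hτj : τ - j * Δ ≤ Δ := by
    have := (div_lt_iff₀ hΔ).1 (Nat.lt_floor_add_one (τ / Δ))
    linarith
  have hjm : j ≤ ⌈Γ / Δ⌉₊ :=
    (Nat.floor_le_ceil _).trans (Nat.ceil_mono (div_le_div_of_nonneg_right hτ.2 hΔ.le))
  have hj0 : (0 : ℝ) ≤ j * Δ := by positivity
  have hjIcc : (j : ℝ) * Δ ∈ Set.Icc 0 Γ := ⟨hj0, hjτ.trans hτ.2⟩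
  have hcurv : ∀ (S : Finset X) s, M.Indep (S : Set X) → s ∈ S →
      (1 - κ) * (auxH ν f α {s} (j * Δ) - auxH ν f α ∅ (j * Δ)) ≤
        auxH ν f α S (j * Δ) - auxH ν f α (S.erase s) (j * Δ) := by
    intro S s hS hs
    refine le_trans (mul_le_mul_of_nonneg_right ?_ ?_)
      (one_sub_curvature_mul_le (hH (j * Δ)) hS hs)
    · linarith [curvature_le_auxCurvature (M := M) hH hjIcc]
    · exact sub_nonneg.2 (hH _ _ _ (Finset.empty_subset _))
  have hgreedy := greedyRounds_spec (hH (j * Δ))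
    (isSubmodular_auxH hmeas hnn hmono hsub hα (j * Δ)) hκ0 hκ1 hη hcurv f α ys (tie (j * Δ))
    (j * Δ) (fun S => happ S j hjm) (Finset.univ : Finset X).toList.length ∅ (by simp)
    (by simp) S hS (Finset.empty_subset _)
  obtain ⟨⟨i, hi, hival⟩, hbest⟩ := sga_val_spec M f α Γ Δ ys tie tiePair
  have hb := hbest j hjm
  set R := (sga M f α Γ Δ ys tie tiePair).val with hR
  have hR2 : R.2 = i * Δ := by rw [hival]
  rw [greedySet] at hb
  set G := (greedyRounds M f α ys (tie (j * Δ)) (Finset.univ : Finset X).toList (j * Δ)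
    (Finset.univ : Finset X).toList.length ∅).val with hG
  have happG := abs_le.1 (happ G j hjm)
  have happR := abs_le.1 (happ R.1 i hi)
  rw [← hR2] at happR
  have hgrid := auxH_sub_le hmeas hnn hα S hjτ
  rw [Finset.length_toList, Finset.card_univ] at hgreedy
  have hempty : -(Γ * (1 / α - 1)) ≤ auxH ν f α ∅ (j * Δ) := by
    rw [auxH_empty hf0 α hj0]
    have : 0 ≤ 1 / α - 1 := by
      rw [sub_nonneg, le_div_iff₀ hα]
      linarith
    exact neg_le_neg (mul_le_mul_of_nonneg_right hjIcc.2 this)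
  have hN : (1 : ℝ) ≤ Fintype.card X := by exact_mod_cast (Fintype.card_pos : 0 < Fintype.card X)
  have hκpos : 0 < 1 + κ := by linarith
  have hlow : auxH ν f α G (j * Δ) - 2 * η ≤ auxH ν f α R.1 R.2 := by linarith
  have hηN : η ≤ η * Fintype.card X := le_mul_of_one_le_right hη hN
  have hmain : 1 / (1 + κ) * (auxH ν f α S τ - Δ) - κ / (1 + κ) * Γ * (1 / α - 1) -
      2 * η * Fintype.card X ≤ auxH ν f α G (j * Δ) := by
    have heq : 1 / (1 + κ) * (auxH ν f α S τ - Δ) - κ / (1 + κ) * Γ * (1 / α - 1) -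
        2 * η * Fintype.card X = ((auxH ν f α S τ - Δ) - κ * (Γ * (1 / α - 1)) -
          2 * η * Fintype.card X * (1 + κ)) / (1 + κ) := by
      field_simp
    rw [heq, div_le_iff₀ hκpos]
    have h1 := mul_le_mul_of_nonneg_left hempty hκ0
    have h2 : 0 ≤ κ * (2 * η * Fintype.card X) := by positivity
    linarith
  linarith

end Guarantee

/-! ### The sample size -/

/-- The sample size pays for the union bound over the `2 ^ |X|` sets. -/
lemma card_finset_mul_exp_le {X : Type*} [Fintype X] {α Γ : ℝ} (hN : 0 < Fintype.card X)
    (hα : 0 < α) (hΓ : 0 < Γ) {ε δ : ℝ} (hε : 0 < ε) (hδ : 0 < δ) (hδ1 : δ ≤ 1) {n : ℕ}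
    (hn : 64 * ((Fintype.card X : ℝ) ^ 3 / α ^ 2) * (Γ ^ 2 / ε ^ 2 * Real.log (2 / δ)) ≤ n) :
    Fintype.card (Finset X) * (2 * Real.exp
      (-(2 * n * (α * ε / (4 * Fintype.card X)) ^ 2 / (2 * Γ) ^ 2))) ≤ δ := by
  rw [Fintype.card_finset]
  generalize Fintype.card X = N at *
  have hN' : (0 : ℝ) < N := by exact_mod_cast hN
  have hle : (2 * N : ℕ) * Real.log (2 / δ) ≤
      2 * n * (α * ε / (4 * N)) ^ 2 / (2 * Γ) ^ 2 := by
    have h : 2 * (N : ℝ) * Real.log (2 / δ) =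
        2 * (64 * ((N : ℝ) ^ 3 / α ^ 2) * (Γ ^ 2 / ε ^ 2 * Real.log (2 / δ))) *
          (α * ε / (4 * N)) ^ 2 / (2 * Γ) ^ 2 := by
      field_simp
      ring
    push_cast
    rw [h]
    gcongr
  have hexp : Real.exp (-(2 * n * (α * ε / (4 * N)) ^ 2 / (2 * Γ) ^ 2)) ≤ (δ / 2) ^ (2 * N) := by
    calc _ ≤ Real.exp (-((2 * N : ℕ) * Real.log (2 / δ))) := Real.exp_le_exp.2 (neg_le_neg hle)
      _ = (δ / 2) ^ (2 * N) := by
        rw [← mul_neg, ← Real.log_inv, inv_div, Real.exp_nat_mul, Real.exp_log (by positivity)]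
  calc ((2 ^ N : ℕ) : ℝ) * (2 * Real.exp (-(2 * n * (α * ε / (4 * N)) ^ 2 / (2 * Γ) ^ 2)))
      ≤ 2 ^ N * (2 * (δ / 2) ^ (2 * N)) := by
        push_cast
        gcongr
    _ = 2 * (δ ^ 2 / 2) ^ N := by
        rw [pow_mul, mul_left_comm, ← mul_pow]
        congr 2
        ring
    _ ≤ 2 * (δ ^ 2 / 2) ^ 1 := by
        gcongr 2 * ?_
        exact pow_le_pow_of_le_one (by positivity) (by nlinarith) hN
    _ ≤ δ := by nlinarith

theorem theorem1 :
    ∃ C : ℝ, 0 < C ∧ ∃ K : ℕ,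
      ∀ (X : Type*) [Fintype X] [DecidableEq X] [Nonempty X]
        (Y : Type*) [MeasurableSpace Y] (ν : Measure Y) [IsProbabilityMeasure ν]
        (M : Matroid X) (f : Finset X → Y → ℝ) (α Γ Δ : ℝ),
        (∀ S, AEMeasurable (f S) ν) →
        (∀ y, f ∅ y = 0) →
        (∀ y S T, S ⊆ T → f S y ≤ f T y) →
        (∀ y, IsSubmodular (fun S => f S y)) →
        0 < α → α ≤ 1 → 0 < Γ → 0 < Δ → Δ ≤ Γ →
        -- approximation guarantee, with the number of samples
        (∀ (ε δ : ℝ) (n : ℕ), 0 < ε → 0 < δ → δ < 1 →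
          C * ((Fintype.card X : ℝ) ^ 3 / α ^ 2) * (Γ ^ 2 / ε ^ 2 * Real.log (2 / δ)) ≤ n →
          ∃ A : Set (Fin n → Y), MeasurableSet A ∧
            ENNReal.ofReal (1 - δ) ≤ Measure.pi (fun _ : Fin n => ν) A ∧
            ∀ ys ∈ A, ∀ tie tiePair,
              M.Indep ((sga M f α Γ Δ (List.ofFn ys) tie tiePair).val.1 : Set X) ∧
              ∀ (Sstar : Finset X) (τstar : ℝ), IsOptimalPair M ν f α Γ Sstar τstar →
                auxH ν f α (sga M f α Γ Δ (List.ofFn ys) tie tiePair).val.1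
                    (sga M f α Γ Δ (List.ofFn ys) tie tiePair).val.2 ≥
                  1 / (1 + auxCurvature M ν f α Γ) * (auxH ν f α Sstar τstar - Δ)
                    - auxCurvature M ν f α Γ / (1 + auxCurvature M ν f α Γ) * Γ * (1 / α - 1)
                    - ε) ∧
        -- running time
        (∀ (n : ℕ), 0 < n → ∀ (ys : Fin n → Y) tie tiePair,
          (sga M f α Γ Δ (List.ofFn ys) tie tiePair).cost ≤
            K * (⌈Γ / Δ⌉₊ * Fintype.card X ^ 2 * n)) := by
  refine ⟨64, by norm_num, 63, ?_⟩
  intro X _ _ _ Y _ ν _ M f α Γ Δ hmeas hf0 hmono hsub hα hα1 hΓ hΔ hΔΓ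
  have hnn : ∀ S y, 0 ≤ f S y := fun S y => hf0 y ▸ hmono y ∅ S (Finset.empty_subset _)
  have hN : 0 < Fintype.card X := Fintype.card_pos
  have hN1 : (1 : ℝ) ≤ Fintype.card X := by exact_mod_cast hN
  refine ⟨?_, ?_⟩
  · intro ε δ n hε hδ hδ1 hn
    set N : ℝ := (Fintype.card X : ℝ) with hNdef
    have hlog : 0 < Real.log (2 / δ) := Real.log_pos (by rw [lt_div_iff₀ hδ]; linarith)
    have hn' : (0 : ℝ) < n := lt_of_lt_of_le (by positivity) hn
    have hn0 : 0 < n := by exact_mod_cast hn'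
    have hmpos : 0 < ⌈Γ / Δ⌉₊ := Nat.ceil_pos.2 (div_pos hΓ hΔ)
    -- The last grid point may exceed `Γ`, but by less than `Δ ≤ Γ`.
    have hL : (⌈Γ / Δ⌉₊ : ℝ) * Δ ≤ 2 * Γ := by
      have h := Nat.ceil_lt_add_one (div_pos hΓ hΔ).le
      have h' := mul_le_mul_of_nonneg_right h.le hΔ.le
      rw [add_mul, div_mul_cancel₀ _ hΔ.ne'] at h'
      linarith
    -- Accuracy `ε / (4 N)` of the oracle allows shortfall errors up to `α ε / (4 N)`.
    set θ : ℝ := α * ε / (4 * N) with hθ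
    have hθ0 : 0 < θ := by positivity
    have hexp : Fintype.card (Finset X) * (2 * Real.exp (-(2 * n * θ ^ 2 / (2 * Γ) ^ 2))) ≤ δ :=
      card_finset_mul_exp_le hN hα hΓ hε hδ hδ1.le hn
    obtain ⟨A, hA, hAprob, hAspec⟩ := exists_measurableSet_forall_abs_shortfall_le (ν := ν) hmeas
      hnn hΔ hmpos hn0 hL hθ0 hexp
    refine ⟨A, hA, hAprob, fun ys hys tie tiePair => ⟨indep_sga_val_fst .., ?_⟩⟩
    intro S τ hopt
    have happ : ∀ S, ∀ j ≤ ⌈Γ / Δ⌉₊,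
        |(oracleH f α (List.ofFn ys) S (j * Δ)).val - auxH ν f α S (j * Δ)| ≤ ε / (4 * N) := by
      intro S j hj
      have h := hAspec ys hys S j hj
      have heq : (oracleH f α (List.ofFn ys) S (j * Δ)).val - auxH ν f α S (j * Δ) =
          -(((∑ i, max (j * Δ - f S (ys i)) 0) / n - ∫ y, max (j * Δ - f S y) 0 ∂ν) / α) := by
        rw [oracleH_val_ofFn, auxH]
        field_simp
        ring
      rw [heq, abs_neg, abs_div, abs_of_pos hα, div_le_iff₀ hα]
      refine h.trans (le_of_eq ?_)
      rw [hθ]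
      ring
    have hmain := sga_guarantee hmeas hnn hf0 hmono hsub hα hα1 hΓ hΔ (by positivity) happ tie
      tiePair hopt.1 hopt.2.1
    have hε' : 4 * (ε / (4 * N)) * Fintype.card X = ε := by
      rw [← hNdef]
      field_simp
    rw [hε'] at hmain
    exact hmain
  · intro n hn ys tie tiePair
    have := sga_cost_le M f hΓ hΔ (α := α) (ys := List.ofFn ys) (by simpa using hn) tie tiePair
    simpa using this
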